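/- All rings are commutative with identity. A ring $A$ is called a splinter if it is Noetherian and every finite ring map $A \to B$ for which $\operatorname{Spec}(B) \to \operatorname{Spec}(A)$ is surjective has a left inverse in the category of $A$-modules. For a local ring $(R,\mathfrak m)$, its Henselization is $R^h = \varinjlim_{(S,\mathfrak q)} S$, the filtered colimit over the category of pairs $(S,\mathfrak q)$ consisting of an étale $R$-algebra $S$ and a prime ideal $\mathfrak q$ of $S$ lying over $\mathfrak m$ such that $\kappa(\mathfrak m) \to \kappa(\mathfrak q)$ is an isomorphism (a morphism $(S,\mathfrak q) \to (S',\mathfrak q')$ is an $R$-algebra map $S \to S'$ under which $\mathfrak q$ is the preimage of $\mathfrak q'$). **Theorem B.** Let $(R,\mathfrak m)$ be a Noetherian local ring. Then $R$ is a splinter if and only if its Henselization $R^h$ is a splinter. -/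

import Mathlib

universe u

open CategoryTheory IsLocalRing

/-- A commutative ring `R` is a *splinter* if it is Noetherian and every finite ring map `R → S`
inducing a surjection `Spec S → Spec R` has a left inverse in the category of `R`-modules.
(A module-finite `R`-algebra is a quotient module of some `Rⁿ`, so up to isomorphism all of them
live in the universe of `R`.) -/
structure IsSplinter (R : Type u) [CommRing R] : Prop where
  isNoetherianRing : IsNoetherianRing R
  exists_leftInverse : ∀ (S : Type u) [CommRing S] [Algebra R S], Module.Finite R S →
    Function.Surjective (PrimeSpectrum.comap (algebraMap R S)) →
    ∃ φ : S →ₗ[R] R, φ ∘ₗ Algebra.linearMap R S = LinearMap.id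

/-- An étale neighbourhood `(S, q)` of a local ring `(R, m)`: an étale `R`-algebra `S` and a prime
`q` of `S` lying over `m` such that `κ(m) → κ(q)` is an isomorphism. An étale algebra is of
finite type, so up to isomorphism it is a quotient of some `R[x₁, …, xₙ]`; taking `S` literally of
this form makes the étale neighbourhoods a small category. -/
structure EtaleNhd (R : Type u) [CommRing R] [IsLocalRing R] : Type u where
  n : ℕ
  I : Ideal (MvPolynomial (Fin n) R)
  etale : Algebra.Etale R (MvPolynomial (Fin n) R ⧸ I)
  q : Ideal (MvPolynomial (Fin n) R ⧸ I)
  isPrime : q.IsPrime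
  liesOver : q.LiesOver (maximalIdeal R)
  bijective_residueField : Function.Bijective
    (Ideal.ResidueField.mapₐ (maximalIdeal R) q (Algebra.ofId R _) (q.over_def (maximalIdeal R)))

namespace EtaleNhd

variable {R : Type u} [CommRing R] [IsLocalRing R]

/-- The underlying étale `R`-algebra of an étale neighbourhood. -/
abbrev Ring (A : EtaleNhd R) : Type u := MvPolynomial (Fin A.n) R ⧸ A.I

/-- A morphism `(S, q) → (S', q')` of étale neighbourhoods is an `R`-algebra homomorphism
`S → S'` under which `q` is the preimage of `q'`. -/
@[ext]
structure Hom (A B : EtaleNhd R) : Type u where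
  toAlgHom : A.Ring →ₐ[R] B.Ring
  comap_eq : B.q.comap toAlgHom = A.q

noncomputable instance : SmallCategory (EtaleNhd R) where
  Hom A B := Hom A B
  id A := ⟨AlgHom.id R A.Ring, Ideal.comap_id A.q⟩
  comp f g := ⟨g.toAlgHom.comp f.toAlgHom, by
    rw [← f.comap_eq, ← g.comap_eq]; rfl⟩

/-- The forgetful functor `(S, q) ↦ S` to commutative rings. -/
noncomputable def forgetToRing (R : Type u) [CommRing R] [IsLocalRing R] : EtaleNhd R ⥤ CommRingCat.{u} where
  obj A := CommRingCat.of A.Ring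
  map f := CommRingCat.ofHom (Hom.toAlgHom f).toRingHom

end EtaleNhd

/-- The *Henselization* `Rʰ` of a local ring `(R, m)`: the (filtered) colimit of the rings `S` over
the category of all étale neighbourhoods `(S, q)` of `(R, m)`. -/
noncomputable def Henselization (R : Type u) [CommRing R] [IsLocalRing R] : Type u :=
  (Limits.colimit (EtaleNhd.forgetToRing R) : CommRingCat.{u})

noncomputable instance (R : Type u) [CommRing R] [IsLocalRing R] : CommRing (Henselization R) :=
  inferInstanceAs (CommRing (Limits.colimit (EtaleNhd.forgetToRing R) : CommRingCat.{u}))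

/-! Splitting is traded for purity: over a Noetherian ring a finite algebra splits as soon as it is
pure (`Algebra.IsPure.exists_leftInverse`), and purity passes along towers and back from an algebra
to anything mapping into it.

Descent. Each R/m^(k+1) is Artinian local, hence Henselian, so Rʰ maps to it; with Krull's
intersection theorem this makes R → Rʰ pure. If S is finite over R and surjective on spectra, so is
its base change to Rʰ, which splits. Hence Rʰ ⊗ S is pure over R, and so is S.

Ascent. A local splinter R is a normal domain. Its absolute integral closure E is a union of finite
extensions, hence pure over R, and conjugation of roots shows that the localization B of E at a
maximal ideal is still pure (`Algebra.IsPure.of_isLocalization_atPrime`). Since B is local and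
normal with algebraically closed fraction field, it is Henselian and receives a map from Rʰ. Every
system over Rʰ is approximated modulo m^k by one over R, so B is pure over Rʰ too
(`Algebra.IsPure.of_dense`). A finite T over Rʰ that is surjective on spectra maps to B, by lifting
a geometric point; so T is pure and splits.

Ascent also needs Rʰ Noetherian. Leading forms in the Noetherian Rees algebra show that an ideal J
has a finitely generated J₀ ≤ J with J ≤ J₀ + m^k Rʰ for all k. Then J = J₀, because finitely
generated ideals of Rʰ are closed: the elements involved live in the Noetherian local ring of one
étale neighbourhood, where Krull applies. -/

/-- An `A`-algebra `B` is *pure* if every finite system of linear equations over `A` which is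
solvable in `B` is solvable in `A`. -/
def Algebra.IsPure (A B : Type*) [CommRing A] [CommRing B] [Algebra A B] : Prop :=
  ∀ ⦃ι κ : Type⦄ [Fintype ι] [Fintype κ] (M : ι → κ → A) (r : ι → A),
    (∃ t : κ → B, ∀ i, ∑ j, M i j • t j = algebraMap A B (r i)) →
      ∃ s : κ → A, ∀ i, ∑ j, M i j * s j = r i

/-! ### Purity and splittings. -/

namespace Algebra.IsPure

variable {A B C : Type*} [CommRing A] [CommRing B] [CommRing C] [Algebra A B] [Algebra A C]

theorem of_leftInverse (φ : B →ₗ[A] A) (hφ : φ 1 = 1) : Algebra.IsPure A B := by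
  rintro ι κ _ _ M r ⟨t, ht⟩
  refine ⟨fun j ↦ φ (t j), fun i ↦ ?_⟩
  have := congrArg φ (ht i)
  simpa [Algebra.algebraMap_eq_smul_one, hφ] using this

theorem of_algHom (f : B →ₐ[A] C) (h : Algebra.IsPure A C) : Algebra.IsPure A B := by
  rintro ι κ _ _ M r ⟨t, ht⟩
  refine h M r ⟨fun j ↦ f (t j), fun i ↦ ?_⟩
  simpa using congrArg f (ht i)

theorem trans [Algebra B C] [IsScalarTower A B C] (h₁ : Algebra.IsPure A B)
    (h₂ : Algebra.IsPure B C) : Algebra.IsPure A C := by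
  rintro ι κ _ _ M r ⟨t, ht⟩
  obtain ⟨s, hs⟩ := h₂ (fun i j ↦ algebraMap A B (M i j)) (fun i ↦ algebraMap A B (r i))
    ⟨t, fun i ↦ by simpa [← IsScalarTower.algebraMap_apply] using ht i⟩
  exact h₁ M r ⟨s, fun i ↦ by simpa [Algebra.smul_def] using hs i⟩

/-- Present B as a quotient of Aⁿ with finitely many relations. A left inverse is a vector in Aⁿ
killed by the relations and sending a lift of 1 to 1: a finite linear system, solved in B by the
images of the basis vectors. -/
theorem exists_leftInverse [IsNoetherianRing A] [Module.Finite A B] (h : Algebra.IsPure A B) :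
    ∃ φ : B →ₗ[A] A, φ ∘ₗ Algebra.linearMap A B = LinearMap.id := by
  obtain ⟨n, f, hf⟩ := Module.Finite.exists_fin' A B
  obtain ⟨m, v, hv⟩ := Submodule.fg_iff_exists_fin_generating_family.mp
    (IsNoetherian.noetherian (LinearMap.ker f))
  obtain ⟨e, he⟩ := hf 1
  have key (x : Fin n → A) : ∑ j, x j • f (Pi.single j 1) = f x := by
    conv_rhs => rw [pi_eq_sum_univ' x]
    simp
  obtain ⟨s, hs⟩ := h (ι := Option (Fin m)) (fun i j ↦ i.elim (e j) fun i ↦ v i j)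
    (fun i ↦ i.elim 1 fun _ ↦ 0) ⟨fun j ↦ f (Pi.single j 1), fun i ↦ by
      cases i with
      | none => simpa [he] using key e
      | some i =>
        have : v i ∈ LinearMap.ker f := hv ▸ Submodule.subset_span ⟨i, rfl⟩
        simpa [LinearMap.mem_ker.mp this] using key (v i)⟩
  let g : (Fin n → A) →ₗ[A] A := ∑ j, s j • LinearMap.proj j
  have hg (x : Fin n → A) : g x = ∑ j, x j * s j := by simp [g, mul_comm]
  have hker : LinearMap.ker f ≤ LinearMap.ker g := by
    rw [← hv, Submodule.span_le]
    rintro _ ⟨i, rfl⟩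
    simpa [hg] using hs (some i)
  refine ⟨(LinearMap.ker f).liftQ g hker ∘ₗ (f.quotKerEquivOfSurjective hf).symm.toLinearMap, ?_⟩
  ext
  have h1 : (f.quotKerEquivOfSurjective hf).symm 1 = Submodule.Quotient.mk e := by
    rw [LinearEquiv.symm_apply_eq]
    simpa using he.symm
  simpa [h1, hg] using hs none

end Algebra.IsPure

/-! ### Approximation modulo powers of an ideal. -/

section Density

variable {R H : Type*} [CommRing R] [CommRing H] [Algebra R H] {I : Ideal R}

theorem Ideal.exists_mem_pow_sub_mem_map_pow
    (hd : ∀ x : H, ∃ r : R, x - algebraMap R H r ∈ I.map (algebraMap R H)) (k : ℕ) {x : H}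
    (hx : x ∈ (I ^ k).map (algebraMap R H)) :
    ∃ r ∈ I ^ k, x - algebraMap R H r ∈ (I ^ (k + 1)).map (algebraMap R H) := by
  refine Submodule.span_induction (p := fun x _ ↦ ∃ r ∈ I ^ k,
    x - algebraMap R H r ∈ (I ^ (k + 1)).map (algebraMap R H)) ?_ ?_ ?_ ?_ hx
  · rintro _ ⟨r, hr, rfl⟩
    exact ⟨r, hr, by simp⟩
  · exact ⟨0, zero_mem _, by simp⟩
  · rintro x y - - ⟨r, hr, hxr⟩ ⟨s, hs, hys⟩
    refine ⟨r + s, add_mem hr hs, ?_⟩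
    rw [map_add, add_sub_add_comm]
    exact add_mem hxr hys
  · rintro a x hx ⟨r, hr, hxr⟩
    obtain ⟨b, hb⟩ := hd a
    refine ⟨b * r, Ideal.mul_mem_left _ _ hr, ?_⟩
    have : a • x - algebraMap R H (b * r) =
        a * (x - algebraMap R H r) + algebraMap R H r * (a - algebraMap R H b) := by
      simp only [map_mul, smul_eq_mul]; ring
    rw [this]
    refine add_mem (Ideal.mul_mem_left _ _ hxr) ?_
    rw [pow_succ, Ideal.map_mul]
    exact Ideal.mul_mem_mul (Ideal.mem_map_of_mem _ hr) hb

theorem Ideal.exists_sub_mem_map_pow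
    (hd : ∀ x : H, ∃ r : R, x - algebraMap R H r ∈ I.map (algebraMap R H)) (k : ℕ) (x : H) :
    ∃ r : R, x - algebraMap R H r ∈ (I ^ k).map (algebraMap R H) := by
  induction k with
  | zero => exact ⟨0, by simp [Ideal.map_top]⟩
  | succ k ih =>
    obtain ⟨r, hr⟩ := ih
    obtain ⟨s, -, hs⟩ := Ideal.exists_mem_pow_sub_mem_map_pow hd k hr
    exact ⟨r + s, by rwa [map_add, ← sub_sub]⟩

theorem Ideal.ker_eq_map_pow
    (hd : ∀ x : H, ∃ r : R, x - algebraMap R H r ∈ I.map (algebraMap R H)) (k : ℕ)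
    (π : H →ₐ[R] R ⧸ I ^ k) : RingHom.ker π = (I ^ k).map (algebraMap R H) := by
  have hle : (I ^ k).map (algebraMap R H) ≤ RingHom.ker π := by
    rw [Ideal.map_le_iff_le_comap]
    intro r hr
    simpa [RingHom.mem_ker, Ideal.Quotient.eq_zero_iff_mem] using hr
  refine le_antisymm (fun x hx ↦ ?_) hle
  obtain ⟨r, hr⟩ := Ideal.exists_sub_mem_map_pow hd k x
  have h1 : π (x - algebraMap R H r) = 0 := hle hr
  rw [map_sub, show π x = 0 from hx, zero_sub, neg_eq_zero, AlgHom.commutes,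
    Ideal.Quotient.algebraMap_eq, Ideal.Quotient.eq_zero_iff_mem] at h1
  simpa using add_mem hr (Ideal.mem_map_of_mem (algebraMap R H) h1)

/-- The elements of the Rees algebra of `I` whose coefficients are leading forms of elements of
the ideal `J`. -/
def Ideal.leadingForms (I : Ideal R) (J : Ideal H) : Ideal (reesAlgebra I) where
  carrier := {f | ∀ k, ∃ j ∈ J,
    algebraMap R H (f.1.coeff k) - j ∈ (I ^ (k + 1)).map (algebraMap R H)}
  zero_mem' k := ⟨0, zero_mem _, by simp⟩
  add_mem' {f g} hf hg k := by
    obtain ⟨a, ha, hfa⟩ := hf k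
    obtain ⟨b, hb, hgb⟩ := hg k
    refine ⟨a + b, add_mem ha hb, ?_⟩
    simpa [add_sub_add_comm] using add_mem hfa hgb
  -- A coefficient of g in degree p lies in I^p, so it moves an error in I^(q+1) into I^(p+q+1).
  smul_mem' g f hf k := by
    choose j hj hfj using hf
    refine ⟨∑ p ∈ Finset.HasAntidiagonal.antidiagonal k, algebraMap R H (g.1.coeff p.1) * j p.2,
      Ideal.sum_mem _ fun p _ ↦ Ideal.mul_mem_left _ _ (hj _), ?_⟩
    simp only [smul_eq_mul, MulMemClass.coe_mul, Polynomial.coeff_mul, map_sum, map_mul,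
      ← Finset.sum_sub_distrib, ← mul_sub]
    refine Ideal.sum_mem _ fun p hp ↦ ?_
    rw [← Finset.HasAntidiagonal.mem_antidiagonal.mp hp, add_assoc, pow_add, Ideal.map_mul]
    exact Ideal.mul_mem_mul (Ideal.mem_map_of_mem _ ((mem_reesAlgebra_iff I _).mp g.2 _)) (hfj _)

/-- The Rees algebra is Noetherian, so finitely many elements of J realise the coefficients of
generators of its ideal of leading forms. Successive approximation by these reaches J modulo every
power of I. -/
theorem Ideal.exists_fg_le_sup_map_pow [IsNoetherianRing R]
    (hd : ∀ x : H, ∃ r : R, x - algebraMap R H r ∈ I.map (algebraMap R H)) (J : Ideal H) :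
    ∃ J₀ ≤ J, J₀.FG ∧ ∀ k, J ≤ J₀ ⊔ (I ^ k).map (algebraMap R H) := by
  classical
  obtain ⟨s, hs⟩ := IsNoetherian.noetherian (Ideal.leadingForms I J)
  have hmem (F : s) : F.1 ∈ Ideal.leadingForms I J := hs ▸ Submodule.subset_span F.2
  choose j hj hFj using hmem
  let t : Finset H := s.attach.biUnion fun F ↦ (F.1.1.support).image (j F)
  have hle : Ideal.leadingForms I J ≤ Ideal.leadingForms I (Ideal.span (t : Set H)) := by
    rw [← hs, Submodule.span_le]
    intro F hF k
    by_cases hk : k ∈ F.1.support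
    · exact ⟨j ⟨F, hF⟩ k, Ideal.subset_span (by
        simp only [t, Finset.coe_biUnion, Set.mem_iUnion]
        exact ⟨⟨F, hF⟩, by simp, by simpa using ⟨k, by simpa using hk, rfl⟩⟩), hFj ⟨F, hF⟩ k⟩
    · exact ⟨0, zero_mem _, by simp [Polynomial.notMem_support_iff.mp hk]⟩
  have htJ : Ideal.span (t : Set H) ≤ J := by
    rw [Ideal.span_le]
    intro x hx
    simp only [t, Finset.coe_biUnion, Set.mem_iUnion, Finset.coe_image, Set.mem_image] at hx
    obtain ⟨F, -, k, -, rfl⟩ := hx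
    exact hj F k
  have step (k : ℕ) (y : H) (hy : y ∈ J) :
      ∃ z ∈ Ideal.span (t : Set H), y - z ∈ (I ^ k).map (algebraMap R H) := by
    induction k with
    | zero => exact ⟨0, zero_mem _, by simp [Ideal.map_top]⟩
    | succ k ih =>
      obtain ⟨z, hz, hyz⟩ := ih
      obtain ⟨a, ha, hya⟩ := Ideal.exists_mem_pow_sub_mem_map_pow hd k hyz
      -- The remaining error y - z is in J, and its leading form is a in degree k.
      have hmon : (⟨Polynomial.monomial k a, reesAlgebra.monomial_mem.mpr ha⟩ : reesAlgebra I) ∈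
          Ideal.leadingForms I J := by
        intro l
        by_cases hl : k = l
        · subst hl
          exact ⟨y - z, sub_mem hy (htJ hz), by
            simpa using neg_mem hya⟩
        · exact ⟨0, zero_mem _, by simp [Polynomial.coeff_monomial, hl]⟩
      obtain ⟨w, hw, haw⟩ := hle hmon k
      refine ⟨z + w, add_mem hz hw, ?_⟩
      rw [Polynomial.coeff_monomial_same] at haw
      convert add_mem hya haw using 1
      ring
  refine ⟨Ideal.span t, htJ, ⟨t, rfl⟩, fun k y hy ↦ ?_⟩
  obtain ⟨z, hz, hyz⟩ := step k y hy
  rw [← add_sub_cancel z y]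
  exact add_mem (Ideal.mem_sup_left hz) (Ideal.mem_sup_right hyz)

end Density

/-! ### Étale neighbourhoods and their maps to local rings. -/

namespace EtaleNhd

open scoped TensorProduct

variable {R : Type u} [CommRing R] [IsLocalRing R]

instance (A : EtaleNhd R) : Algebra.Etale R A.Ring := A.etale

instance (A : EtaleNhd R) : A.q.IsPrime := A.isPrime

instance (A : EtaleNhd R) : A.q.LiesOver (maximalIdeal R) := A.liesOver

/-- The evaluation of functions at the distinguished point, with values in the residue field
of `R`. -/
noncomputable def residueMap (A : EtaleNhd R) :
    A.Ring →ₐ[R] (maximalIdeal R).ResidueField :=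
  (AlgEquiv.ofBijective _ A.bijective_residueField).symm.toAlgHom.comp
    (IsScalarTower.toAlgHom R A.Ring A.q.ResidueField)

theorem residueMap_eq_zero_iff (A : EtaleNhd R) {x : A.Ring} : A.residueMap x = 0 ↔ x ∈ A.q := by
  simp [residueMap]

theorem ker_residueMap (A : EtaleNhd R) : RingHom.ker A.residueMap = A.q :=
  Ideal.ext fun _ ↦ A.residueMap_eq_zero_iff

theorem exists_sub_mem (A : EtaleNhd R) (x : A.Ring) :
    ∃ r : R, x - algebraMap R A.Ring r ∈ A.q := by
  obtain ⟨r, hr⟩ := (maximalIdeal R).algebraMap_residueField_surjective (A.residueMap x)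
  exact ⟨r, by rw [← residueMap_eq_zero_iff, map_sub, AlgHom.commutes, hr, sub_self]⟩

theorem algHom_ext_of_ker_eq {S : Type*} [CommRing S] [Algebra R S]
    {f g : S →ₐ[R] (maximalIdeal R).ResidueField} (h : RingHom.ker f = RingHom.ker g) : f = g := by
  ext x
  obtain ⟨r, hr⟩ := (maximalIdeal R).algebraMap_residueField_surjective (f x)
  have : x - algebraMap R S r ∈ RingHom.ker f := by simp [RingHom.mem_ker, hr]
  rw [h, RingHom.mem_ker, map_sub, AlgHom.commutes, hr, sub_eq_zero] at this
  exact this.symm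

/-- An étale algebra with a rational point over the closed point gives an étale neighbourhood. -/
theorem exists_algEquiv (S : Type u) [CommRing S] [Algebra R S] [Algebra.Etale R S]
    (ρ : S →ₐ[R] (maximalIdeal R).ResidueField) :
    ∃ (A : EtaleNhd R) (e : A.Ring ≃ₐ[R] S), A.residueMap = ρ.comp e.toAlgHom := by
  obtain ⟨n, f, hf⟩ := Algebra.FiniteType.iff_quotient_mvPolynomial''.mp
    (inferInstance : Algebra.FiniteType R S)
  let e : (MvPolynomial (Fin n) R ⧸ RingHom.ker f) ≃ₐ[R] S :=
    Ideal.quotientKerAlgEquivOfSurjective hf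
  let σ := ρ.comp e.toAlgHom
  have hσ (x) : ∃ r : R, x - algebraMap R _ r ∈ RingHom.ker σ := by
    obtain ⟨r, hr⟩ := (maximalIdeal R).algebraMap_residueField_surjective (σ x)
    exact ⟨r, by simp [RingHom.mem_ker, hr]⟩
  have hmax : (RingHom.ker σ).IsMaximal := RingHom.ker_isMaximal_of_surjective σ fun y ↦ by
    obtain ⟨r, rfl⟩ := (maximalIdeal R).algebraMap_residueField_surjective y
    exact ⟨algebraMap R _ r, by simp⟩
  have hlies : (RingHom.ker σ).LiesOver (maximalIdeal R) := ⟨by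
    ext r
    simp [Ideal.mem_comap, RingHom.mem_ker]⟩
  let A : EtaleNhd R :=
    { n := n
      I := RingHom.ker f
      etale := Algebra.Etale.of_equiv e.symm
      q := RingHom.ker σ
      isPrime := hmax.isPrime
      liesOver := hlies
      bijective_residueField := by
        refine ⟨fun x y h ↦ RingHom.injective (Ideal.ResidueField.map _ _ _ _) h, fun y ↦ ?_⟩
        obtain ⟨x, rfl⟩ := Ideal.algebraMap_residueField_surjective _ y
        obtain ⟨r, hr⟩ := hσ x
        refine ⟨algebraMap R _ r, ?_⟩
        rw [AlgHom.commutes, eq_comm, ← sub_eq_zero, IsScalarTower.algebraMap_apply R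
          (MvPolynomial (Fin n) R ⧸ RingHom.ker f) (RingHom.ker σ).ResidueField, ← map_sub]
        exact Ideal.algebraMap_residueField_eq_zero.mpr hr }
  exact ⟨A, e, algHom_ext_of_ker_eq A.ker_residueMap⟩

/-- A map of étale algebras compatible with the residue maps is a morphism of étale
neighbourhoods. -/
def homMk {A B : EtaleNhd R} (f : A.Ring →ₐ[R] B.Ring)
    (h : B.residueMap.comp f = A.residueMap) : A ⟶ B :=
  Hom.mk f (by rw [← ker_residueMap, ← ker_residueMap, ← h]; rfl)

/-- The tensor product is étale, and the two rational points combine to one on it. -/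
theorem exists_hom_hom (A B : EtaleNhd R) :
    ∃ C : EtaleNhd R, Nonempty (A ⟶ C) ∧ Nonempty (B ⟶ C) := by
  have : Algebra.Etale R (A.Ring ⊗[R] B.Ring) := Algebra.Etale.comp R A.Ring _
  obtain ⟨C, e, he⟩ := exists_algEquiv (A.Ring ⊗[R] B.Ring)
    (Algebra.TensorProduct.lift A.residueMap B.residueMap fun _ _ ↦ .all _ _)
  refine ⟨C, ⟨homMk (e.symm.toAlgHom.comp Algebra.TensorProduct.includeLeft) ?_⟩,
    ⟨homMk (e.symm.toAlgHom.comp Algebra.TensorProduct.includeRight) ?_⟩⟩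
  · ext x; simp [he]
  · ext x; simp [he]

theorem exists_hom_isUnit (A : EtaleNhd R) {s : A.Ring} (hs : s ∉ A.q) :
    ∃ (C : EtaleNhd R) (f : A ⟶ C), IsUnit (Hom.toAlgHom f s) := by
  have hu : IsUnit (A.residueMap s) := by
    rwa [isUnit_iff_ne_zero, Ne, residueMap_eq_zero_iff]
  obtain ⟨C, e, he⟩ := exists_algEquiv (Localization.Away s)
    (IsLocalization.Away.liftAlgHom s (f := A.residueMap) hu)
  refine ⟨C, homMk (e.symm.toAlgHom.comp (IsScalarTower.toAlgHom R A.Ring _)) ?_, ?_⟩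
  · ext x; simp [he]
  · exact (IsLocalization.Away.algebraMap_isUnit s).map e.symm

theorem exists_forall_nonempty_hom : ∃ A : EtaleNhd R, ∀ B : EtaleNhd R, Nonempty (A ⟶ B) := by
  obtain ⟨A, e, he⟩ := exists_algEquiv R (Algebra.ofId R (maximalIdeal R).ResidueField)
  refine ⟨A, fun B ↦ ⟨homMk ((Algebra.ofId R B.Ring).comp e.toAlgHom) ?_⟩⟩
  ext x
  obtain ⟨r, rfl⟩ := e.symm.surjective x
  simp [he, Algebra.ofId_apply]

section Lift

variable (A : EtaleNhd R) (C : Type*) [CommRing C] [Algebra R C]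

/-- The differences f x - g x generate the image J of the kernel of multiplication. That kernel is
finitely generated and, as Ω = 0, idempotent. Rationality of the point puts J in the maximal ideal,
so J = 0 by Nakayama. -/
theorem algHom_ext_of_comap_eq [IsLocalRing C] {A : EtaleNhd R} {f g : A.Ring →ₐ[R] C}
    (hf : (maximalIdeal C).comap f = A.q) (hg : (maximalIdeal C).comap g = A.q) : f = g := by
  let φ : A.Ring ⊗[R] A.Ring →ₐ[R] C := Algebra.TensorProduct.lift f g fun _ _ ↦ .all _ _
  let J : Ideal C := (KaehlerDifferential.ideal R A.Ring).map φ
  have hsub (x : A.Ring) : f x - g x ∈ maximalIdeal C := by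
    obtain ⟨r, hr⟩ := A.exists_sub_mem x
    have h1 := hr
    rw [← hf, Ideal.mem_comap, map_sub, AlgHom.commutes] at h1
    rw [← hg, Ideal.mem_comap, map_sub, AlgHom.commutes] at hr
    simpa using sub_mem h1 hr
  have hJ : J ≤ maximalIdeal C := by
    rw [Ideal.map_le_iff_le_comap, ← KaehlerDifferential.span_range_eq_ideal, Ideal.span_le]
    rintro _ ⟨x, rfl⟩
    have := neg_mem (hsub x)
    simpa [φ] using this
  have hidem : IsIdempotentElem (KaehlerDifferential.ideal R A.Ring) :=
    (Ideal.cotangent_subsingleton_iff _).mp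
      (inferInstance : Subsingleton (KaehlerDifferential R A.Ring))
  have hbot : J = ⊥ := by
    refine Submodule.eq_bot_of_le_smul_of_le_jacobson_bot (maximalIdeal C) J
      ((KaehlerDifferential.ideal_fg R A.Ring).map _) ?_ (maximalIdeal_le_jacobson _)
    calc J = J * J := by rw [← Ideal.map_mul, hidem]
      _ ≤ maximalIdeal C • J := Ideal.mul_mono_left hJ
  ext x
  have : φ (1 ⊗ₜ x - x ⊗ₜ 1) ∈ J := Ideal.mem_map_of_mem _
    (by simp [KaehlerDifferential.ideal, RingHom.mem_ker])
  rw [hbot, Ideal.mem_bot] at this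
  exact (sub_eq_zero.mp (by simpa [φ] using this)).symm

/-- Near q the algebra is standard étale, so a map to C is a root of one monic polynomial at which
`P.g` is a unit. The rational point gives an approximate simple root in R, which Hensel's lemma
corrects in C. -/
theorem exists_algHom_comap_eq [HenselianLocalRing C] [IsLocalHom (algebraMap R C)] :
    ∃ f : A.Ring →ₐ[R] C, (maximalIdeal C).comap f = A.q := by
  obtain ⟨s, hs, hstd⟩ := Algebra.IsEtaleAt.exists_isStandardEtale (R := R) A.q
  obtain ⟨P⟩ := hstd.nonempty_standardEtalePresentation
  have hu : IsUnit (A.residueMap s) := by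
    rwa [isUnit_iff_ne_zero, Ne, residueMap_eq_zero_iff]
  let ρ : Localization.Away s →ₐ[R] (maximalIdeal R).ResidueField :=
    IsLocalization.Away.liftAlgHom s (f := A.residueMap) hu
  obtain ⟨a, ha⟩ := (maximalIdeal R).algebraMap_residueField_surjective (ρ P.x)
  have hP : P.HasMap (algebraMap R (maximalIdeal R).ResidueField a) := ha ▸ P.hasMap.map ρ
  have haeval (p : Polynomial R) : Polynomial.aeval (algebraMap R (maximalIdeal R).ResidueField a) p
      = algebraMap R _ (p.eval a) := by simp [Polynomial.aeval_algebraMap_apply]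
  have hunit {p : Polynomial R} (hp : IsUnit (Polynomial.aeval
      (algebraMap R (maximalIdeal R).ResidueField a) p)) : IsUnit (p.eval a) := by
    rw [haeval, isUnit_iff_ne_zero, Ne, Ideal.algebraMap_residueField_eq_zero] at hp
    simpa using hp
  have hf : P.f.eval a ∈ maximalIdeal R := by
    rw [← Ideal.algebraMap_residueField_eq_zero, ← haeval]
    exact hP.1
  obtain ⟨c, hc, hca⟩ := HenselianLocalRing.is_henselian (P.f.map (algebraMap R C))
    (P.monic_f.map _) (algebraMap R C a)
    (by simpa [Polynomial.eval_map_algebraMap, Polynomial.aeval_algebraMap_apply] using hf)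
    (by simpa [Polynomial.derivative_map, Polynomial.eval_map_algebraMap,
      Polynomial.aeval_algebraMap_apply] using (hunit hP.isUnit_derivative_f).map (algebraMap R C))
  have hcP : P.HasMap c := by
    refine ⟨by simpa [Polynomial.IsRoot, Polynomial.eval_map_algebraMap] using hc, ?_⟩
    have h1 : IsUnit (Polynomial.aeval (algebraMap R C a) P.g) := by
      simpa [Polynomial.aeval_algebraMap_apply] using (hunit hP.2).map (algebraMap R C)
    have h2 : Polynomial.aeval c P.g - Polynomial.aeval (algebraMap R C a) P.g ∈
        maximalIdeal C := by
      have := Polynomial.sub_dvd_eval_sub c (algebraMap R C a) (P.g.map (algebraMap R C))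
      rw [Polynomial.eval_map_algebraMap, Polynomial.eval_map_algebraMap] at this
      exact Ideal.mem_of_dvd _ this hca
    rw [← notMem_maximalIdeal] at h1 ⊢
    intro h3
    exact h1 (by simpa using sub_mem h3 h2)
  let F : Localization.Away s →ₐ[R] C := (P.lift c hcP).comp P.equivRing.toAlgHom
  have hF : F P.x = c := by simp [F]
  let j : (maximalIdeal R).ResidueField →ₐ[R] ResidueField C :=
    Ideal.ResidueField.liftₐ (maximalIdeal R) (Algebra.ofId R (ResidueField C))
      (fun r hr ↦ by
        rw [RingHom.mem_ker, Algebra.ofId_apply, IsScalarTower.algebraMap_apply R C,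
          ResidueField.algebraMap_eq, residue_eq_zero_iff]
        simpa using hr)
      (fun r hr ↦ by
        have : IsUnit r := by simpa [Ideal.primeCompl] using hr
        exact this.map (Algebra.ofId R (ResidueField C)))
  -- Both residue maps agree on the generator, as c and a have the same residue; this identifies the
  -- preimage of the maximal ideal of C with q.
  have hj : (IsScalarTower.toAlgHom R C (ResidueField C)).comp F = j.comp ρ := by
    refine P.hom_ext ?_
    simp only [AlgHom.comp_apply, hF, ← ha, AlgHom.commutes, IsScalarTower.coe_toAlgHom',
      IsScalarTower.algebraMap_apply R C (ResidueField C)]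
    rw [← sub_eq_zero, ← map_sub, ResidueField.algebraMap_eq, residue_eq_zero_iff]
    exact hca
  refine ⟨F.comp (IsScalarTower.toAlgHom R A.Ring _), ?_⟩
  ext x
  have hx := DFunLike.congr_fun hj (algebraMap A.Ring (Localization.Away s) x)
  have hρ : ρ (algebraMap A.Ring (Localization.Away s) x) = A.residueMap x := by
    simp [ρ, IsLocalization.Away.liftAlgHom_apply]
  simp only [AlgHom.comp_apply, hρ, IsScalarTower.coe_toAlgHom', ResidueField.algebraMap_eq] at hx
  rw [Ideal.mem_comap, AlgHom.comp_apply, IsScalarTower.coe_toAlgHom', ← residue_eq_zero_iff, hx,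
    ← residueMap_eq_zero_iff]
  exact map_eq_zero_iff j (RingHom.injective (RingHomClass.toRingHom j))

end Lift

end EtaleNhd

/-! ### The Henselization as a colimit: elements and universal property. -/

namespace Henselization

variable {R : Type u} [CommRing R] [IsLocalRing R]

open EtaleNhd

/-- The canonical map from an étale neighbourhood to the Henselization. -/
noncomputable def ι (A : EtaleNhd R) : A.Ring →+* Henselization R :=
  (Limits.colimit.ι (EtaleNhd.forgetToRing R) A).hom

theorem ι_comp {A B : EtaleNhd R} (f : A ⟶ B) (x : A.Ring) : ι B (Hom.toAlgHom f x) = ι A x :=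
  congrArg (fun g ↦ g.hom x) (Limits.colimit.w (EtaleNhd.forgetToRing R) f)

noncomputable instance : Algebra R (Henselization R) :=
  ((ι (exists_forall_nonempty_hom (R := R)).choose).comp (algebraMap R _)).toAlgebra

theorem ι_algebraMap (A : EtaleNhd R) (r : R) :
    ι A (algebraMap R A.Ring r) = algebraMap R (Henselization R) r := by
  obtain ⟨f⟩ := (exists_forall_nonempty_hom (R := R)).choose_spec A
  rw [← (Hom.toAlgHom f).commutes r, ι_comp]
  rfl

/-- The canonical `R`-algebra map from an étale neighbourhood to the Henselization. -/
noncomputable def ιₐ (A : EtaleNhd R) : A.Ring →ₐ[R] Henselization R where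
  __ := ι A
  commutes' := ι_algebraMap A

theorem ιₐ_comp {A B : EtaleNhd R} (f : A ⟶ B) (x : A.Ring) :
    ιₐ B (Hom.toAlgHom f x) = ιₐ A x :=
  ι_comp f x

theorem exists_ringHom {C : Type u} [CommRing C] (f : ∀ A : EtaleNhd R, A.Ring →+* C)
    (hf : ∀ {A B : EtaleNhd R} (g : A ⟶ B) (x : A.Ring), f B (Hom.toAlgHom g x) = f A x) :
    ∃ F : Henselization R →+* C, ∀ A x, F (ιₐ A x) = f A x := by
  let c : Limits.Cocone (EtaleNhd.forgetToRing R) :=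
    { pt := CommRingCat.of C
      ι := { app := fun A ↦ CommRingCat.ofHom (f A)
             naturality := fun A B g ↦ by ext x; exact hf g x } }
  exact ⟨(Limits.colimit.desc _ c).hom, fun A x ↦
    congrArg (fun g ↦ g.hom x) (Limits.colimit.ι_desc c A)⟩

theorem ringHom_ext {C : Type u} [CommRing C] {f g : Henselization R →+* C}
    (h : ∀ (A : EtaleNhd R) (x : A.Ring), f (ιₐ A x) = g (ιₐ A x)) : f = g := by
  have : CommRingCat.ofHom f = CommRingCat.ofHom g :=
    Limits.colimit.hom_ext fun A ↦ by ext x; exact h A x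
  exact congrArg CommRingCat.Hom.hom this

theorem exists_ιₐ_eq (x : Henselization R) : ∃ (A : EtaleNhd R) (a : A.Ring), ιₐ A a = x := by
  have A₀ : EtaleNhd R := (exists_forall_nonempty_hom (R := R)).choose
  have key {x y : Henselization R} (hx : ∃ (A : EtaleNhd R) (a : A.Ring), ιₐ A a = x)
      (hy : ∃ (A : EtaleNhd R) (a : A.Ring), ιₐ A a = y) :
      ∃ (A : EtaleNhd R) (a b : A.Ring), ιₐ A a = x ∧ ιₐ A b = y := by
    obtain ⟨A, a, rfl⟩ := hx
    obtain ⟨B, b, rfl⟩ := hy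
    obtain ⟨C, ⟨f⟩, ⟨g⟩⟩ := exists_hom_hom A B
    exact ⟨C, Hom.toAlgHom f a, Hom.toAlgHom g b, ιₐ_comp f a, ιₐ_comp g b⟩
  -- The represented elements form a subring by directedness. The colimit maps to it compatibly with
  -- the inclusion, so it is everything.
  let S : Subring (Henselization R) :=
    { carrier := {x | ∃ (A : EtaleNhd R) (a : A.Ring), ιₐ A a = x}
      mul_mem' := fun hx hy ↦ by
        obtain ⟨A, a, b, rfl, rfl⟩ := key hx hy
        exact ⟨A, a * b, map_mul _ _ _⟩
      one_mem' := ⟨A₀, 1, map_one _⟩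
      add_mem' := fun hx hy ↦ by
        obtain ⟨A, a, b, rfl, rfl⟩ := key hx hy
        exact ⟨A, a + b, map_add _ _ _⟩
      zero_mem' := ⟨A₀, 0, map_zero _⟩
      neg_mem' := fun ⟨A, a, h⟩ ↦ ⟨A, -a, by rw [map_neg, h]⟩ }
  obtain ⟨F, hF⟩ := exists_ringHom (C := S)
    (fun A ↦ (ιₐ A).toRingHom.codRestrict S fun a ↦ ⟨A, a, rfl⟩)
    (fun g x ↦ Subtype.ext (ιₐ_comp g x))
  have : S.subtype.comp F = RingHom.id _ := ringHom_ext fun A x ↦ congrArg Subtype.val (hF A x)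
  have hx : (F x).1 = x := DFunLike.congr_fun this x
  exact hx ▸ (F x).2

theorem exists_forall_ιₐ_eq {n : ℕ} (x : Fin n → Henselization R) :
    ∃ (A : EtaleNhd R) (a : Fin n → A.Ring), ∀ i, ιₐ A (a i) = x i := by
  induction n with
  | zero => exact ⟨(exists_forall_nonempty_hom (R := R)).choose, Fin.elim0, fun i ↦ i.elim0⟩
  | succ n ih =>
    obtain ⟨A, a, ha⟩ := ih fun i ↦ x i.succ
    obtain ⟨B, b, hb⟩ := exists_ιₐ_eq (x 0)
    obtain ⟨C, ⟨f⟩, ⟨g⟩⟩ := exists_hom_hom A B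
    refine ⟨C, Fin.cons (Hom.toAlgHom g b) fun i ↦ Hom.toAlgHom f (a i), fun i ↦ ?_⟩
    cases i using Fin.cases with
    | zero => simpa [ιₐ_comp] using hb
    | succ i => simpa [ιₐ_comp] using ha i

/-- The universal property of the Henselization. -/
theorem nonempty_algHom (C : Type u) [CommRing C] [Algebra R C] [HenselianLocalRing C]
    [IsLocalHom (algebraMap R C)] : Nonempty (Henselization R →ₐ[R] C) := by
  choose f hf using fun A : EtaleNhd R ↦ A.exists_algHom_comap_eq C
  obtain ⟨F, hF⟩ := exists_ringHom (fun A ↦ (f A).toRingHom) (fun {A B} g x ↦ by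
    have : (f B).comp (Hom.toAlgHom g) = f A :=
      algHom_ext_of_comap_eq _ (by rw [← g.comap_eq, ← hf B]; rfl) (hf A)
    exact DFunLike.congr_fun this x)
  refine ⟨{ F with commutes' := fun r ↦ ?_ }⟩
  have A : EtaleNhd R := (exists_forall_nonempty_hom (R := R)).choose
  have := hF A (algebraMap R _ r)
  rw [AlgHom.commutes] at this
  exact this.trans ((f A).commutes r)

theorem isUnit_ιₐ (A : EtaleNhd R) {s : A.Ring} (hs : s ∉ A.q) : IsUnit (ιₐ A s) := by
  obtain ⟨C, f, hf⟩ := A.exists_hom_isUnit hs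
  exact ιₐ_comp f s ▸ hf.map (ιₐ C)

/-- The canonical map from the local ring of an étale neighbourhood to the Henselization. -/
noncomputable def localι (A : EtaleNhd R) (L : Type*) [CommRing L] [Algebra A.Ring L]
    [Algebra R L] [IsScalarTower R A.Ring L] [IsLocalization.AtPrime L A.q] : L →ₐ[R] Henselization R :=
  IsLocalization.liftAlgHom (M := A.q.primeCompl) (f := ιₐ A) fun s ↦ isUnit_ιₐ A s.2

theorem localι_algebraMap (A : EtaleNhd R) (L : Type*) [CommRing L] [Algebra A.Ring L]
    [Algebra R L] [IsScalarTower R A.Ring L] [IsLocalization.AtPrime L A.q]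
    (a : A.Ring) : localι A L (algebraMap A.Ring L a) = ιₐ A a := by
  simp [localι]

theorem map_maximalIdeal_localization (A : EtaleNhd R) (L : Type*) [CommRing L] [Algebra A.Ring L]
    [Algebra R L] [IsScalarTower R A.Ring L] [IsLocalization.AtPrime L A.q]
    [IsLocalRing L] :
    (maximalIdeal R).map (algebraMap R L) = maximalIdeal L := by
  have : IsLocalHom (algebraMap R L) := by
    refine ((local_hom_TFAE _).out 0 4 rfl rfl).mpr ?_
    rw [IsScalarTower.algebraMap_eq R A.Ring, ← Ideal.comap_comap]
    refine (congrArg _ (IsLocalization.AtPrime.under_maximalIdeal L A.q)).trans ?_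
    exact (A.q.over_def (maximalIdeal R)).symm
  have : Algebra.FormallyEtale A.Ring L := .of_isLocalization A.q.primeCompl
  have : Algebra.FormallyEtale R L := .comp R A.Ring L
  have : Algebra.EssFiniteType A.Ring L := .of_isLocalization _ A.q.primeCompl
  have : Algebra.EssFiniteType R L := .comp R A.Ring L
  exact Algebra.FormallyUnramified.map_maximalIdeal

theorem exists_sub_mem_map_localization (A : EtaleNhd R) (L : Type*) [CommRing L] [Algebra A.Ring L]
    [Algebra R L] [IsScalarTower R A.Ring L] [IsLocalization.AtPrime L A.q]
    (x : L) :
    ∃ r : R, x - algebraMap R L r ∈ (maximalIdeal R).map (algebraMap R L) := by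
  have : IsLocalRing L := IsLocalization.AtPrime.isLocalRing L A.q
  let ρ : L →ₐ[R] (maximalIdeal R).ResidueField :=
    IsLocalization.liftAlgHom (M := A.q.primeCompl) (f := A.residueMap) fun s ↦ by
      rw [isUnit_iff_ne_zero, Ne, residueMap_eq_zero_iff]
      exact s.2
  obtain ⟨r, hr⟩ := (maximalIdeal R).algebraMap_residueField_surjective (ρ x)
  refine ⟨r, ?_⟩
  rw [map_maximalIdeal_localization A L]
  exact le_maximalIdeal (RingHom.ker_ne_top ρ) (by simp [RingHom.mem_ker, hr])

theorem ιₐ_mem_map_of_localization (A : EtaleNhd R) (L : Type*) [CommRing L]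
    [Algebra A.Ring L] [Algebra R L] [IsScalarTower R A.Ring L] [IsLocalization.AtPrime L A.q]
    {a : A.Ring} (ha : a ∈ A.q) :
    ιₐ A a ∈ (maximalIdeal R).map (algebraMap R (Henselization R)) := by
  have : IsLocalRing L := IsLocalization.AtPrime.isLocalRing L A.q
  have := Ideal.mem_map_of_mem (localι A L)
    ((IsLocalization.AtPrime.to_map_mem_maximal_iff L A.q a).mpr ha)
  rwa [localι_algebraMap, ← map_maximalIdeal_localization A L, ← Ideal.map_coe (localι A L),
    Ideal.map_map, AlgHom.comp_algebraMap] at this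

theorem ιₐ_mem_map {A : EtaleNhd R} {a : A.Ring} (ha : a ∈ A.q) :
    ιₐ A a ∈ (maximalIdeal R).map (algebraMap R (Henselization R)) :=
  ιₐ_mem_map_of_localization A (Localization.AtPrime A.q) ha

theorem exists_sub_mem_map (x : Henselization R) :
    ∃ r : R, x - algebraMap R _ r ∈ (maximalIdeal R).map (algebraMap R (Henselization R)) := by
  obtain ⟨A, a, rfl⟩ := exists_ιₐ_eq x
  obtain ⟨r, hr⟩ := A.exists_sub_mem a
  exact ⟨r, by simpa using ιₐ_mem_map hr⟩

theorem isUnit_of_notMem_map {x : Henselization R}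
    (hx : x ∉ (maximalIdeal R).map (algebraMap R (Henselization R))) : IsUnit x := by
  obtain ⟨A, a, rfl⟩ := exists_ιₐ_eq x
  exact isUnit_ιₐ A fun ha ↦ hx (ιₐ_mem_map ha)

end Henselization

/-! ### Henselian Artinian quotients and Krull's theorem. -/

section Quotient

variable {R : Type u} [CommRing R] [IsLocalRing R]

instance (k : ℕ) : Nontrivial (R ⧸ maximalIdeal R ^ (k + 1)) :=
  Ideal.Quotient.nontrivial_iff.mpr fun h ↦ (maximalIdeal.isMaximal R).ne_top
    (top_le_iff.mp (h ▸ Ideal.pow_le_self k.succ_ne_zero))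

instance (k : ℕ) : IsLocalHom (algebraMap R (R ⧸ maximalIdeal R ^ (k + 1))) :=
  IsLocalHom.of_surjective _ Ideal.Quotient.mk_surjective

instance [IsNoetherianRing R] (k : ℕ) : HenselianLocalRing (R ⧸ maximalIdeal R ^ (k + 1)) := by
  have hloc : IsLocalRing (R ⧸ maximalIdeal R ^ (k + 1)) :=
    IsLocalRing.of_surjective' _ Ideal.Quotient.mk_surjective
  have : IsArtinianRing (R ⧸ maximalIdeal R ^ (k + 1)) := by
    rw [isArtinianRing_iff_isNilpotent_maximalIdeal]
    refine ⟨k + 1, ?_⟩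
    rw [← map_maximalIdeal_of_surjective (Ideal.Quotient.mk (maximalIdeal R ^ (k + 1)))
      Ideal.Quotient.mk_surjective, ← Ideal.map_pow, Ideal.map_quotient_self]
    rfl
  have : HenselianRing (R ⧸ maximalIdeal R ^ (k + 1)) (maximalIdeal _) := inferInstance
  exact { hloc with
    is_henselian := fun f hf a h₁ h₂ ↦ this.is_henselian f hf a h₁ (h₂.map _) }

end Quotient

/-- Krull's intersection theorem: submodules are closed in the adic topology. -/
theorem Submodule.mem_of_forall_mem_sup_pow_smul_top {R M : Type*} [CommRing R] [IsLocalRing R]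
    [IsNoetherianRing R] [AddCommGroup M] [Module R M] [Module.Finite R M] {N : Submodule R M}
    {x : M} (h : ∀ k, x ∈ N ⊔ maximalIdeal R ^ k • (⊤ : Submodule R M)) : x ∈ N := by
  rw [← Submodule.Quotient.mk_eq_zero]
  refine (inferInstance : IsHausdorff (maximalIdeal R) (M ⧸ N)).haus' _ fun k ↦ ?_
  rw [SModEq.zero]
  have := Submodule.mem_map_of_mem (f := N.mkQ) (h k)
  rwa [Submodule.map_sup, Submodule.mkQ_map_self, bot_sup_eq, Submodule.map_smul'',
    Submodule.map_top, Submodule.range_mkQ] at this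

/-- If `R → L → H` become isomorphisms modulo all powers of the maximal ideal of `R`, then ideals of
the Noetherian local ring `L` are contracted from the adic completion of `H`. -/
theorem Ideal.mem_span_range_of_forall_map_mem {R L H : Type*} [CommRing R] [IsLocalRing R]
    [CommRing L] [IsLocalRing L] [IsNoetherianRing L] [CommRing H] [Algebra R L] [Algebra R H]
    (hm : (maximalIdeal R).map (algebraMap R L) = maximalIdeal L)
    (hL : ∀ x : L, ∃ r : R, x - algebraMap R L r ∈ (maximalIdeal R).map (algebraMap R L))
    (hH : ∀ x : H, ∃ r : R, x - algebraMap R H r ∈ (maximalIdeal R).map (algebraMap R H))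
    (hπ : ∀ k, Nonempty (H →ₐ[R] R ⧸ maximalIdeal R ^ (k + 1))) (φ : L →ₐ[R] H)
    {n : ℕ} {y : L} {x : Fin n → L}
    (h : ∀ k, φ y ∈ Ideal.span (Set.range fun i ↦ φ (x i)) ⊔
      (maximalIdeal R ^ k).map (algebraMap R H)) :
    y ∈ Ideal.span (Set.range x) := by
  refine Submodule.mem_of_forall_mem_sup_pow_smul_top fun k ↦ ?_
  obtain ⟨π⟩ := hπ k
  obtain ⟨z, hz, w, hw, hzw⟩ := Submodule.mem_sup.mp (h (k + 1))
  rw [← Ideal.ker_eq_map_pow hH _ π, RingHom.mem_ker] at hw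
  obtain ⟨c, rfl⟩ := (Submodule.mem_span_range_iff_exists_fun _).mp hz
  -- Modulo m^(k+1) the coefficients in H may be replaced by elements of R, so the relation can be
  -- read in L.
  choose r hr using fun i ↦ Ideal.Quotient.mk_surjective (π (c i))
  have h1 : y - ∑ i, algebraMap R L (r i) * x i ∈ RingHom.ker (π.comp φ) := by
    rw [RingHom.mem_ker]
    simp only [AlgHom.comp_apply, map_sub, map_sum, map_mul, AlgHom.commutes,
      ← hzw, map_add, hw, smul_eq_mul, Ideal.Quotient.algebraMap_eq, hr]
    simp
  rw [Ideal.ker_eq_map_pow hL, Ideal.map_pow, hm] at h1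
  rw [← add_sub_cancel (∑ i, algebraMap R L (r i) * x i) y]
  refine Submodule.add_mem_sup (Ideal.sum_mem _ fun i _ ↦ ?_) ?_
  · exact Ideal.mul_mem_left _ _ (Ideal.subset_span ⟨i, rfl⟩)
  · simpa using Ideal.pow_le_pow_right k.le_succ h1

/-! ### The Henselization is local and Noetherian. -/

namespace Henselization

open EtaleNhd

variable {R : Type u} [CommRing R] [IsLocalRing R] [IsNoetherianRing R]

theorem map_maximalIdeal_ne_top :
    (maximalIdeal R).map (algebraMap R (Henselization R)) ≠ ⊤ := by
  obtain ⟨π⟩ := nonempty_algHom (R := R) (R ⧸ maximalIdeal R ^ (0 + 1))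
  have := Ideal.ker_eq_map_pow exists_sub_mem_map _ π
  intro h
  refine RingHom.ker_ne_top π (this.trans (top_le_iff.mp ?_))
  simp [h]

theorem mem_map_maximalIdeal_iff {x : Henselization R} :
    x ∈ (maximalIdeal R).map (algebraMap R (Henselization R)) ↔ ¬ IsUnit x :=
  ⟨fun hx hu ↦ map_maximalIdeal_ne_top (Ideal.eq_top_of_isUnit_mem _ hx hu),
    fun hu ↦ by_contra fun hx ↦ hu (isUnit_of_notMem_map hx)⟩

instance : IsLocalRing (Henselization R) :=
  have : Nontrivial (Henselization R) :=
    ⟨1, 0, fun h ↦ map_maximalIdeal_ne_top (R := R) ((Ideal.eq_top_iff_one _).mpr (h ▸ zero_mem _))⟩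
  IsLocalRing.of_nonunits_add fun a b ha hb ↦ by
    rw [mem_nonunits_iff, ← mem_map_maximalIdeal_iff] at *
    exact add_mem ha hb

theorem map_maximalIdeal :
    (maximalIdeal R).map (algebraMap R (Henselization R)) = maximalIdeal (Henselization R) :=
  Ideal.ext fun _ ↦ mem_map_maximalIdeal_iff

theorem ιₐ_mem_span_range_of_forall_mem_sup (A : EtaleNhd R) (L : Type*) [CommRing L]
    [Algebra A.Ring L] [Algebra R L] [IsScalarTower R A.Ring L] [IsLocalization.AtPrime L A.q]
    {n : ℕ} {y : A.Ring} {x : Fin n → A.Ring}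
    (h : ∀ k, ιₐ A y ∈ Ideal.span (Set.range fun i ↦ ιₐ A (x i)) ⊔
      (maximalIdeal R ^ k).map (algebraMap R (Henselization R))) :
    ιₐ A y ∈ Ideal.span (Set.range fun i ↦ ιₐ A (x i)) := by
  have : IsLocalRing L := IsLocalization.AtPrime.isLocalRing L A.q
  have : IsNoetherianRing L := IsLocalization.isNoetherianRing A.q.primeCompl L inferInstance
  simp only [← localι_algebraMap A L] at h ⊢
  have key := Ideal.mem_span_range_of_forall_map_mem (map_maximalIdeal_localization A L)
    (exists_sub_mem_map_localization A L) exists_sub_mem_map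
    (fun k ↦ nonempty_algHom (R ⧸ maximalIdeal R ^ (k + 1))) (localι A L) h
  have := Ideal.mem_map_of_mem (localι A L) key
  rwa [Ideal.map_span, ← Set.range_comp] at this

theorem mem_span_range_of_forall_mem_sup {n : ℕ} {y : Henselization R} {x : Fin n → Henselization R}
    (h : ∀ k, y ∈ Ideal.span (Set.range x) ⊔
      (maximalIdeal R ^ k).map (algebraMap R (Henselization R))) :
    y ∈ Ideal.span (Set.range x) := by
  obtain ⟨A, a, ha⟩ := exists_forall_ιₐ_eq (Fin.cons y x : Fin (n + 1) → Henselization R)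
  obtain rfl : ιₐ A (a 0) = y := by simpa using ha 0
  obtain rfl : (fun i ↦ ιₐ A (a (Fin.succ i))) = x := funext fun i ↦ by simpa using ha i.succ
  exact ιₐ_mem_span_range_of_forall_mem_sup A (Localization.AtPrime A.q) h

instance : IsNoetherianRing (Henselization R) := by
  rw [isNoetherianRing_iff_ideal_fg]
  intro J
  obtain ⟨J₀, hJ₀, hfg, hJ⟩ := Ideal.exists_fg_le_sup_map_pow
    (exists_sub_mem_map (R := R)) J
  suffices J ≤ J₀ from le_antisymm this hJ₀ ▸ hfg
  intro y hy
  obtain ⟨n, x, rfl⟩ := Submodule.fg_iff_exists_fin_generating_family.mp hfg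
  exact mem_span_range_of_forall_mem_sup fun k ↦ hJ k hy

end Henselization

/-! ### First properties of splinters. -/

namespace IsSplinter

variable {R : Type u} [CommRing R]

theorem exists_leftInverse_of_injective (hR : IsSplinter R) (S : Type u) [CommRing S] [Algebra R S]
    [Module.Finite R S] [FaithfulSMul R S] :
    ∃ φ : S →ₗ[R] R, φ 1 = 1 := by
  obtain ⟨φ, hφ⟩ := hR.exists_leftInverse S inferInstance (Algebra.IsIntegral.comap_surjective R S)
  exact ⟨φ, by simpa using DFunLike.congr_fun hφ 1⟩

/-- Split R → ∏ R/p over the minimal primes. The images of the idempotents sum to 1, so one is a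
unit as R is local; the corresponding p annihilates it, so p = 0. -/
theorem isDomain [IsLocalRing R] (hR : IsSplinter R) : IsDomain R := by
  classical
  have := hR.isNoetherianRing
  have : Finite (minimalPrimes R) := minimalPrimes.finite_of_isNoetherianRing R
  cases nonempty_fintype (minimalPrimes R)
  let S := ∀ p : minimalPrimes R, R ⧸ p.1
  have hS : Function.Surjective (PrimeSpectrum.comap (algebraMap R S)) := by
    intro P
    obtain ⟨p, hp, hpP⟩ := Ideal.exists_minimalPrimes_le (bot_le : ⊥ ≤ P.asIdeal)
    have hmem : P ∈ Set.range (PrimeSpectrum.comap (Ideal.Quotient.mk p)) := by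
      rw [range_comap_of_surjective _ _ Ideal.Quotient.mk_surjective]
      simpa using hpP
    obtain ⟨Q, hQ⟩ := hmem
    refine ⟨PrimeSpectrum.comap (Pi.evalRingHom (fun p : minimalPrimes R ↦ R ⧸ p.1) ⟨p, hp⟩) Q, ?_⟩
    rw [← hQ]
    rfl
  obtain ⟨φ, hφ⟩ := hR.exists_leftInverse S inferInstance hS
  have h1 : ∑ p, φ (Pi.single p 1) = 1 := by
    rw [← map_sum, Finset.univ_sum_single (fun p : minimalPrimes R ↦ (1 : R ⧸ p.1))]
    have := DFunLike.congr_fun hφ 1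
    rwa [LinearMap.comp_apply, Algebra.linearMap_apply, map_one] at this
  obtain ⟨p, hp⟩ : ∃ p, IsUnit (φ (Pi.single p 1)) := by
    by_contra! h
    refine (maximalIdeal.isMaximal R).ne_top ((Ideal.eq_top_iff_one _).mpr ?_)
    rw [← h1]
    exact sum_mem fun p _ ↦ h p
  have hbot : p.1 = ⊥ := by
    refine eq_bot_iff.mpr fun x hx ↦ ?_
    have h2 : x • (Pi.single p 1 : S) = 0 := by
      rw [← Pi.single_smul, Algebra.smul_def, mul_one, Ideal.Quotient.algebraMap_eq,
        Ideal.Quotient.eq_zero_iff_mem.mpr hx, Pi.single_zero]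
    have h3 := congrArg φ h2
    rw [map_smul, map_zero, smul_eq_mul] at h3
    exact hp.mul_left_eq_zero.mp h3
  have : (⊥ : Ideal R).IsPrime := hbot ▸ Ideal.IsMinimalPrime.isPrime p.2
  exact IsDomain.of_bot_isPrime R

/-- If x = a/b is integral, a splitting φ of R[x] gives b φ(x) = φ(bx) = a, so x = φ(x). -/
theorem isIntegrallyClosed [IsDomain R] (hR : IsSplinter R) : IsIntegrallyClosed R := by
  refine (isIntegrallyClosed_iff (FractionRing R)).mpr fun {x} hx ↦ ?_
  have := Algebra.finite_adjoin_simple_of_isIntegral hx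
  obtain ⟨φ, hφ⟩ := hR.exists_leftInverse_of_injective (Algebra.adjoin R {x})
  obtain ⟨⟨a, b⟩, hab⟩ := IsLocalization.surj (nonZeroDivisors R) x
  let y : Algebra.adjoin R {x} := ⟨x, Algebra.self_mem_adjoin_singleton R x⟩
  have hy : b.1 • y = a • 1 := Subtype.ext (by
    simpa [Algebra.smul_def, mul_comm, y] using hab)
  have h := congrArg φ hy
  simp only [map_smul, hφ, smul_eq_mul, mul_one] at h
  refine ⟨φ y, ?_⟩
  rw [← h, map_mul, mul_comm] at hab
  exact (mul_left_cancel₀ (IsFractionRing.to_map_ne_zero_of_mem_nonZeroDivisors b.2) hab).symm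

/-- The finitely many coordinates of a solution generate a finite subalgebra, which splits. -/
theorem isPure_of_isIntegral (hR : IsSplinter R) (E : Type u) [CommRing E] [Algebra R E]
    [Algebra.IsIntegral R E] [FaithfulSMul R E] : Algebra.IsPure R E := by
  rintro ι κ _ _ M r ⟨t, ht⟩
  let S := Algebra.adjoin R (Set.range t)
  have : Module.Finite R S := Algebra.finite_adjoin_of_finite_of_isIntegral (Set.finite_range t)
    fun x _ ↦ Algebra.IsIntegral.isIntegral x
  have : FaithfulSMul R S := (faithfulSMul_iff_algebraMap_injective R S).mpr fun x y h ↦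
    FaithfulSMul.algebraMap_injective R E (congrArg Subtype.val h)
  obtain ⟨φ, hφ⟩ := hR.exists_leftInverse_of_injective S
  exact Algebra.IsPure.of_leftInverse φ hφ M r
    ⟨fun j ↦ ⟨t j, Algebra.subset_adjoin ⟨j, rfl⟩⟩, fun i ↦ Subtype.ext (by simpa using ht i)⟩

end IsSplinter

/-! ### Absolute integral closures and their localizations. -/

section AlgClosed

open Polynomial

theorem IsIntegrallyClosed.exists_eq_prod_X_sub_C {B : Type*} [CommRing B] [IsIntegrallyClosed B]
    [IsDomain B] (F : Type*) [Field F] [Algebra B F] [IsFractionRing B F] [IsAlgClosed F]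
    {f : B[X]} (hf : f.Monic) : ∃ s : Multiset B, f = (s.map fun b ↦ X - C b).prod := by
  have hlift (s : Multiset F) (hs : ∀ a ∈ s, IsIntegral B a) :
      ∃ t : Multiset B, t.map (algebraMap B F) = s := by
    induction s using Multiset.induction with
    | empty => exact ⟨0, rfl⟩
    | cons a s ih =>
      obtain ⟨t, ht⟩ := ih fun b hb ↦ hs b (Multiset.mem_cons_of_mem hb)
      obtain ⟨b, hb⟩ := IsIntegrallyClosed.isIntegral_iff.mp (hs a (Multiset.mem_cons_self a s))
      exact ⟨b ::ₘ t, by simp [hb, ht]⟩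
  obtain ⟨s, hs⟩ := hlift (f.map (algebraMap B F)).roots fun a ha ↦ ⟨f, hf, by
    simpa [IsRoot, eval_map] using! (mem_roots'.mp ha).2⟩
  refine ⟨s, Polynomial.map_injective _ (IsFractionRing.injective B F) ?_⟩
  conv_lhs => rw [(IsAlgClosed.splits (f.map (algebraMap B F))).eq_prod_roots_of_monic (hf.map _)]
  rw [← hs, Polynomial.map_multiset_prod, Multiset.map_map, Multiset.map_map]
  simp

/-- Monic polynomials split over B. If f(a) lies in the maximal ideal, so does some factor a - b,
and b is the required root. -/
theorem HenselianLocalRing.of_isAlgClosed {B : Type*} [CommRing B] [IsIntegrallyClosed B]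
    [IsDomain B] [hB : IsLocalRing B] (F : Type*) [Field F] [Algebra B F] [IsFractionRing B F]
    [IsAlgClosed F] : HenselianLocalRing B where
  is_henselian f hf a ha _ := by
    obtain ⟨s, rfl⟩ := IsIntegrallyClosed.exists_eq_prod_X_sub_C F hf
    rw [eval_multiset_prod, Multiset.map_map] at ha
    obtain ⟨c, hc, hca⟩ :=
      ((maximalIdeal.isMaximal B).isPrime.multiset_prod_mem_iff_exists_mem _).mp ha
    obtain ⟨b, hb, rfl⟩ := Multiset.mem_map.mp hc
    have hab : a - b ∈ maximalIdeal B := by simpa using hca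
    refine ⟨b, ?_, by simpa using neg_mem hab⟩
    rw [IsRoot, eval_multiset_prod, Multiset.map_map]
    exact Multiset.prod_eq_zero (Multiset.mem_map.mpr ⟨b, hb, by simp⟩)

/-- A geometric point of `Spec A` lifts along an integral map which is surjective on spectra. -/
theorem nonempty_algHom_of_comap_surjective {A T Ω : Type*} [CommRing A] [CommRing T] [Algebra A T]
    [Algebra.IsIntegral A T] (h : Function.Surjective (PrimeSpectrum.comap (algebraMap A T)))
    [Field Ω] [IsAlgClosed Ω] [Algebra A Ω] : Nonempty (T →ₐ[A] Ω) := by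
  let p : Ideal A := RingHom.ker (algebraMap A Ω)
  have hp : p.IsPrime := RingHom.ker_isPrime _
  obtain ⟨Q, hQ⟩ := h ⟨p, hp⟩
  have : Q.asIdeal.LiesOver p := ⟨congrArg PrimeSpectrum.asIdeal hQ.symm⟩
  algebraize [Ideal.Quotient.lift p (algebraMap A Ω) fun _ h ↦ h]
  have hinj : Function.Injective (algebraMap (A ⧸ p) Ω) :=
    RingHom.kerLift_injective (algebraMap A Ω)
  have : FaithfulSMul (A ⧸ p) Ω := (faithfulSMul_iff_algebraMap_injective _ _).mpr hinj
  have : IsScalarTower A (A ⧸ p) Ω := .of_algebraMap_eq' rfl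
  have : IsDomain (A ⧸ p) := Ideal.Quotient.isDomain p
  have : IsDomain (T ⧸ Q.asIdeal) := Ideal.Quotient.isDomain _
  have : Module.IsTorsionFree (A ⧸ p) (T ⧸ Q.asIdeal) :=
    Module.isTorsionFree_iff_faithfulSMul.mpr inferInstance
  have : Module.IsTorsionFree (A ⧸ p) Ω := Module.isTorsionFree_iff_faithfulSMul.mpr inferInstance
  let f : T ⧸ Q.asIdeal →ₐ[A ⧸ p] Ω := IsAlgClosed.lift
  exact ⟨(f.restrictScalars A).comp (Ideal.Quotient.mkₐ A Q.asIdeal)⟩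

theorem nonempty_algHom_of_isIntegrallyClosed {A T B : Type*} [CommRing A] [CommRing T]
    [Algebra A T] [Algebra.IsIntegral A T]
    (h : Function.Surjective (PrimeSpectrum.comap (algebraMap A T)))
    [CommRing B] [IsIntegrallyClosed B] [IsDomain B] [Algebra A B]
    (F : Type*) [Field F] [Algebra B F] [IsFractionRing B F] [IsAlgClosed F] :
    Nonempty (T →ₐ[A] B) := by
  algebraize [(algebraMap B F).comp (algebraMap A B)]
  obtain ⟨f⟩ := nonempty_algHom_of_comap_surjective h (Ω := F)
  have hf (x : T) : f x ∈ (IsScalarTower.toAlgHom A B F).range := by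
    have hx : IsIntegral A (f x) := (Algebra.IsIntegral.isIntegral x).map f
    exact IsIntegrallyClosed.isIntegral_iff.mp hx.tower_top
  let e := AlgEquiv.ofInjective (IsScalarTower.toAlgHom A B F) (IsFractionRing.injective B F)
  exact ⟨e.symm.toAlgHom.comp (f.codRestrict _ hf)⟩

/-- A prime P of B is the kernel of a geometric point, which extends to T and hence to the tensor
product. -/
theorem PrimeSpectrum.comap_surjective_baseChange {A T B : Type*} [CommRing A] [CommRing T]
    [Algebra A T] [Algebra.IsIntegral A T]
    (h : Function.Surjective (PrimeSpectrum.comap (algebraMap A T))) [CommRing B] [Algebra A B] :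
    Function.Surjective (PrimeSpectrum.comap (algebraMap B (TensorProduct A B T))) := by
  intro P
  let Ω := AlgebraicClosure P.asIdeal.ResidueField
  obtain ⟨f⟩ := nonempty_algHom_of_comap_surjective h (Ω := Ω)
  let g : TensorProduct A B T →ₐ[A] Ω :=
    Algebra.TensorProduct.lift (IsScalarTower.toAlgHom A B Ω) f fun _ _ ↦ .all _ _
  refine ⟨⟨RingHom.ker g, RingHom.ker_isPrime _⟩, PrimeSpectrum.ext (Ideal.ext fun b ↦ ?_)⟩
  have : g (algebraMap B _ b) = algebraMap B Ω b := by simp [g]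
  rw [PrimeSpectrum.comap_asIdeal, Ideal.mem_comap, RingHom.mem_ker, this,
    IsScalarTower.algebraMap_apply B P.asIdeal.ResidueField Ω, map_eq_zero,
    Ideal.algebraMap_residueField_eq_zero]

theorem exists_algHom_apply_eq_of_aeval_minpoly_eq_zero {R : Type*} [CommRing R] [IsDomain R]
    [IsIntegrallyClosed R] {F : Type*} [Field F] [Algebra R F] [Algebra (FractionRing R) F]
    [IsScalarTower R (FractionRing R) F] [Normal (FractionRing R) F]
    {u a : integralClosure R F} (h : aeval a (minpoly R u) = 0) :
    ∃ σ : integralClosure R F →ₐ[R] integralClosure R F, σ u = a := by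
  have hu : IsIntegral R u := Algebra.IsIntegral.isIntegral u
  have hmin : minpoly (FractionRing R) (u : F) = (minpoly R u).map (algebraMap R _) :=
    minpoly.isIntegrallyClosed_eq_field_fractions (FractionRing R) F hu
  have huK : IsIntegral (FractionRing R) (u : F) := (u.2 : IsIntegral R (u : F)).tower_top
  have hconj : IsConjRoot (FractionRing R) (u : F) a := by
    rw [isConjRoot_iff_aeval_eq_zero huK, hmin, aeval_map_algebraMap]
    have := congrArg (integralClosure R F).val h
    rwa [← aeval_algHom_apply, map_zero] at this
  obtain ⟨σ, hσ⟩ := isConjRoot_iff_exists_algEquiv.mp hconj.symm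
  exact ⟨(σ.toAlgHom.restrictScalars R).mapIntegralClosure, Subtype.ext hσ⟩

theorem integralClosure.isFractionRing_of_algebraic_fractionRing {R F : Type*} [CommRing R]
    [IsDomain R] [Field F] [Algebra R F] [Algebra (FractionRing R) F]
    [IsScalarTower R (FractionRing R) F] [Algebra.IsAlgebraic (FractionRing R) F] :
    IsFractionRing (integralClosure R F) F :=
  have : Algebra.IsAlgebraic R F := IsFractionRing.comap_isAlgebraic_iff.mpr
    (inferInstance : Algebra.IsAlgebraic (FractionRing R) F)
  integralClosure.isFractionRing_of_algebraic fun _ hx ↦ IsFractionRing.to_map_eq_zero_iff.mp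
    ((map_eq_zero (algebraMap (FractionRing R) F)).mp
      ((IsScalarTower.algebraMap_apply _ _ _ _).symm.trans hx))

theorem integralClosure_isIntegrallyClosed {R F : Type*} [CommRing R] [Field F] [Algebra R F]
    [IsFractionRing (integralClosure R F) F] : IsIntegrallyClosed (integralClosure R F) :=
  (isIntegrallyClosed_iff F).mpr fun {x} hx ↦
    ⟨⟨x, isIntegral_trans x hx⟩, rfl⟩

/-- Let `E` be an integral extension of the integrally closed local ring `R` such that conjugate
elements of `E` are related by an automorphism. Then solvability of linear systems over `R` in the
localization of `E` at one maximal ideal implies their solvability in `E`. -/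
theorem Algebra.IsPure.of_isLocalization_atPrime {R E : Type*} [CommRing R] [IsLocalRing R]
    [CommRing E] [IsDomain E] [IsIntegrallyClosed E] [Algebra R E] [Algebra.IsIntegral R E]
    (F : Type*) [Field F] [IsAlgClosed F] [Algebra E F] [IsFractionRing E F]
    (hE : ∀ {u a : E}, aeval a (minpoly R u) = 0 → ∃ σ : E →ₐ[R] E, σ u = a)
    (n : Ideal E) [n.IsMaximal] (B : Type*) [CommRing B] [Algebra R B] [Algebra E B]
    [IsScalarTower R E B] [IsLocalization.AtPrime B n]
    (h : Algebra.IsPure R E) : Algebra.IsPure R B := by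
  rintro ι κ _ _ M r ⟨t, ht⟩
  -- J is the ideal of denominators u for which the system with right side u r is solvable in E. It
  -- is stable under R-endomorphisms of E.
  let J : Ideal E :=
    { carrier := {u | ∃ t : κ → E, ∀ i, ∑ j, M i j • t j = r i • u}
      zero_mem' := ⟨0, by simp⟩
      add_mem' := fun {u v} ⟨s, hs⟩ ⟨t, ht⟩ ↦ ⟨s + t, fun i ↦ by
        simp [Finset.sum_add_distrib, hs, ht]⟩
      smul_mem' := fun c u ⟨t, ht⟩ ↦ ⟨c • t, fun i ↦ by
        simp [smul_comm _ c, ← Finset.smul_sum, ht, -smul_eq_mul]⟩ }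
  suffices hJ : J = ⊤ by
    obtain ⟨t, ht⟩ := (Ideal.eq_top_iff_one J).mp hJ
    exact h M r ⟨t, fun i ↦ by rw [ht, Algebra.algebraMap_eq_smul_one]⟩
  have hconj (σ : E →ₐ[R] E) {u : E} (hu : u ∈ J) : σ u ∈ J := by
    obtain ⟨t, ht⟩ := hu
    exact ⟨fun j ↦ σ (t j), fun i ↦ by simpa using congrArg σ (ht i)⟩
  obtain ⟨u, hun, huJ⟩ : ∃ u ∉ n, u ∈ J := by
    obtain ⟨u, hu⟩ := IsLocalization.exist_integer_multiples_of_finite n.primeCompl t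
    choose s hs using hu
    refine ⟨u, u.2, s, fun i ↦ IsLocalization.injective B n.primeCompl_le_nonZeroDivisors ?_⟩
    simp only [map_sum, Algebra.smul_def, map_mul,
      ← IsScalarTower.algebraMap_apply R E B] at hs ht ⊢
    simp only [hs, mul_left_comm _ (algebraMap E B u), ← Finset.mul_sum, ht]
    rw [mul_comm]
  by_contra hJ
  obtain ⟨n', hn', hJn'⟩ := Ideal.exists_le_maximal J hJ
  have hcomap (N : Ideal E) [N.IsMaximal] : N.comap (algebraMap R E) = maximalIdeal R :=
    eq_maximalIdeal (Ideal.isMaximal_comap_of_isIntegral_of_isMaximal N)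
  have hu : IsIntegral R u := Algebra.IsIntegral.isIntegral u
  let f := minpoly R u
  have hfm : f.Monic := minpoly.monic hu
  obtain ⟨s, hs⟩ := IsIntegrallyClosed.exists_eq_prod_X_sub_C F (hfm.map (algebraMap R E))
  have hsn (a) (ha : a ∈ s) : a ∈ n' := by
    obtain ⟨σ, rfl⟩ := hE (u := u) (a := a) (by
      rw [← eval_map_algebraMap, hs, eval_multiset_prod, Multiset.map_map]
      exact Multiset.prod_eq_zero (Multiset.mem_map.mpr ⟨a, ha, by simp⟩))
    exact hJn' (hconj σ huJ)
  -- All conjugates of u lie in J ≤ n', so the lower coefficients of f lie in n' ∩ R = m = n ∩ R.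
  -- Then f(u) = 0 forces u into n, a contradiction.
  have hmod : f.map (algebraMap R (E ⧸ n')) = X ^ f.natDegree := by
    have h1 : f.map (algebraMap R (E ⧸ n')) = X ^ Multiset.card s := by
      rw [IsScalarTower.algebraMap_eq R E (E ⧸ n'), ← Polynomial.map_map, hs,
        Polynomial.map_multiset_prod, Multiset.map_map]
      rw [Multiset.map_congr rfl (g := fun _ ↦ X) fun a ha ↦ by
        simp [Ideal.Quotient.eq_zero_iff_mem.mpr (hsn a ha)]]
      simp
    have h2 : f.natDegree = Multiset.card s := by
      rw [← hfm.natDegree_map (algebraMap R (E ⧸ n')), h1, natDegree_X_pow]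
    rw [h1, h2]
  have hcoeff (i) (hi : i < f.natDegree) : algebraMap R E (f.coeff i) ∈ n := by
    have h1 := congrArg (fun p ↦ p.coeff i) hmod
    simp only [coeff_map, coeff_X_pow, hi.ne, if_false] at h1
    rw [IsScalarTower.algebraMap_apply R E (E ⧸ n'), Ideal.Quotient.algebraMap_eq,
      Ideal.Quotient.eq_zero_iff_mem, ← Ideal.mem_comap, hcomap n', ← hcomap n] at h1
    exact h1
  have h0 : aeval u f = 0 := minpoly.aeval R u
  rw [aeval_eq_sum_range, Finset.sum_range_succ, hfm.coeff_natDegree, one_smul] at h0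
  refine hun (Ideal.IsPrime.mem_of_pow_mem ‹n.IsMaximal›.isPrime f.natDegree ?_)
  rw [eq_neg_of_add_eq_zero_right h0]
  refine neg_mem (sum_mem fun i hi ↦ ?_)
  rw [Algebra.smul_def]
  exact Ideal.mul_mem_right _ _ (hcoeff i (Finset.mem_range.mp hi))

end AlgClosed

/-! ### Solving linear systems modulo powers of the maximal ideal. -/

theorem Submodule.mem_smul_top_of_forall_mem {R ι : Type*} [CommRing R] [Fintype ι] {I : Ideal R}
    {v : ι → R} (hv : ∀ i, v i ∈ I) : v ∈ I • (⊤ : Submodule R (ι → R)) := by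
  classical
  rw [pi_eq_sum_univ' v]
  exact sum_mem fun i _ ↦ Submodule.smul_mem_smul (hv i) trivial

/-- By Krull's intersection theorem, a linear system over a Noetherian local ring is solvable if it
is solvable modulo all powers of the maximal ideal. -/
theorem IsLocalRing.exists_sum_mul_eq_of_forall_pow {A ι κ : Type*} [CommRing A] [IsLocalRing A]
    [IsNoetherianRing A] [Fintype ι] [Fintype κ] (M : ι → κ → A) (r : ι → A)
    (h : ∀ k, ∃ s : κ → A, ∀ i, r i - ∑ j, M i j * s j ∈ maximalIdeal A ^ k) :
    ∃ s : κ → A, ∀ i, ∑ j, M i j * s j = r i := by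
  have hr : r ∈ LinearMap.range (Matrix.mulVecLin (Matrix.of M)) := by
    refine Submodule.mem_of_forall_mem_sup_pow_smul_top fun k ↦ ?_
    obtain ⟨s, hs⟩ := h k
    rw [← add_sub_cancel (Matrix.mulVecLin (Matrix.of M) s) r]
    exact Submodule.add_mem_sup (LinearMap.mem_range_self _ s)
      (Submodule.mem_smul_top_of_forall_mem fun i ↦ hs i)
  obtain ⟨s, hs⟩ := hr
  exact ⟨s, fun i ↦ congrFun hs i⟩

section Dense

variable {R H : Type*} [CommRing R] [IsLocalRing R] [CommRing H] [Algebra R H]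

theorem Algebra.IsPure.of_forall_nonempty_algHom [IsNoetherianRing R]
    (hπ : ∀ k, Nonempty (H →ₐ[R] R ⧸ maximalIdeal R ^ (k + 1))) : Algebra.IsPure R H := by
  rintro ι κ _ _ M r ⟨t, ht⟩
  refine exists_sum_mul_eq_of_forall_pow M r fun k ↦ ?_
  obtain ⟨π⟩ := hπ k
  choose s hs using fun j ↦ Ideal.Quotient.mk_surjective (π (t j))
  refine ⟨s, fun i ↦ Ideal.pow_le_pow_right k.le_succ ?_⟩
  rw [← Ideal.Quotient.eq_zero_iff_mem, map_sub, sub_eq_zero, map_sum]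
  have := congrArg π (ht i)
  simp only [map_sum, map_smul, AlgHom.commutes] at this
  simpa [hs, Algebra.smul_def] using this.symm

theorem Algebra.IsPure.of_dense [IsNoetherianRing R] [IsLocalRing H] [IsNoetherianRing H]
    (hm : (maximalIdeal R).map (algebraMap R H) = maximalIdeal H)
    (hd : ∀ x : H, ∃ r : R, x - algebraMap R H r ∈ (maximalIdeal R).map (algebraMap R H))
    {B : Type*} [CommRing B] [Algebra R B] [Algebra H B] [IsScalarTower R H B]
    (hB : Algebra.IsPure R B) : Algebra.IsPure H B := by
  classical
  rintro ι κ _ _ M r ⟨t, ht⟩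
  refine exists_sum_mul_eq_of_forall_pow M r fun k ↦ ?_
  rw [← hm, ← Ideal.map_pow]
  choose M₀ hM using fun i j ↦ Ideal.exists_sub_mem_map_pow hd k (M i j)
  choose r₀ hr using fun i ↦ Ideal.exists_sub_mem_map_pow hd k (r i)
  obtain ⟨n, g, hg⟩ := Submodule.fg_iff_exists_fin_generating_family.mp
    (IsNoetherian.noetherian (maximalIdeal R ^ k))
  have hmap {x : H} (hx : x ∈ (maximalIdeal R ^ k).map (algebraMap R H)) :
      algebraMap H B x ∈ (maximalIdeal R ^ k).map (algebraMap R B) := by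
    have := Ideal.mem_map_of_mem (algebraMap H B) hx
    rwa [Ideal.map_map, ← IsScalarTower.algebraMap_eq] at this
  have hz (i : ι) : ∑ j, M₀ i j • t j - algebraMap R B (r₀ i) ∈
      (maximalIdeal R ^ k).map (algebraMap R B) := by
    have h1 : ∑ j, M₀ i j • t j - algebraMap R B (r₀ i) =
        algebraMap H B (r i - algebraMap R H (r₀ i)) -
          ∑ j, algebraMap H B (M i j - algebraMap R H (M₀ i j)) * t j := by
      simp only [map_sub, ← ht, sub_mul, Finset.sum_sub_distrib, Algebra.smul_def,
        ← IsScalarTower.algebraMap_apply]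
      ring
    rw [h1]
    exact sub_mem (hmap (hr i)) (sum_mem fun j _ ↦ Ideal.mul_mem_right _ _ (hmap (hM i j)))
  have hspan : (maximalIdeal R ^ k).map (algebraMap R B) =
      Ideal.span (Set.range fun l ↦ algebraMap R B (g l)) := by
    rw [← hg, Ideal.submodule_span_eq, Ideal.map_span, ← Set.range_comp]
    rfl
  simp only [hspan, Ideal.span, Submodule.mem_span_range_iff_exists_fun] at hz
  choose b hb using hz
  -- Extra unknowns, n for each equation, are the coefficients of the error on generators of m^k.
  -- They turn a congruence in B into an exact system over R.
  obtain ⟨s, hs⟩ := hB (κ := κ ⊕ ι × Fin n)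
    (fun i ↦ Sum.elim (M₀ i) fun p ↦ if p.1 = i then -g p.2 else 0) r₀
    ⟨Sum.elim t fun p ↦ b p.1 p.2, fun i ↦ by
      have hbi := hb i
      simp only [Fintype.sum_sum_type, Sum.elim_inl, Sum.elim_inr, Fintype.sum_prod_type, ite_smul,
        zero_smul, neg_smul]
      rw [Finset.sum_eq_single i (fun i' _ hi' ↦ by simp [hi']) (by simp)]
      simp only [if_true, Finset.sum_neg_distrib]
      rw [← sub_eq_add_neg, sub_eq_iff_eq_add, ← sub_eq_iff_eq_add', ← hbi]
      exact Finset.sum_congr rfl fun l _ ↦ by rw [smul_eq_mul, mul_comm, Algebra.smul_def]⟩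
  refine ⟨fun j ↦ algebraMap R H (s (.inl j)), fun i ↦ ?_⟩
  have hsi : r₀ i - ∑ j, M₀ i j * s (.inl j) ∈ maximalIdeal R ^ k := by
    rw [← hs i]
    simp only [Fintype.sum_sum_type, Sum.elim_inl, Sum.elim_inr, add_sub_cancel_left]
    refine sum_mem fun p _ ↦ Ideal.mul_mem_right _ _ ?_
    split_ifs
    · exact neg_mem (hg ▸ Submodule.subset_span ⟨_, rfl⟩)
    · exact zero_mem _
  have h2 : r i - ∑ j, M i j * algebraMap R H (s (.inl j)) =
      (r i - algebraMap R H (r₀ i)) + algebraMap R H (r₀ i - ∑ j, M₀ i j * s (.inl j)) -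
        ∑ j, (M i j - algebraMap R H (M₀ i j)) * algebraMap R H (s (.inl j)) := by
    simp only [map_sub, map_sum, map_mul, sub_mul, Finset.sum_sub_distrib]
    ring
  rw [h2]
  exact sub_mem (add_mem (hr i) (Ideal.mem_map_of_mem _ hsi))
    (sum_mem fun j _ ↦ Ideal.mul_mem_right _ _ (hM i j))

end Dense

/-! ### The pure Henselian extension and the two implications. -/

theorem Algebra.IsPure.exists_isPure_henselianLocalRing {R E F : Type u} [CommRing R]
    [IsLocalRing R] [CommRing E] [IsDomain E] [IsIntegrallyClosed E] [Algebra R E]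
    [Algebra.IsIntegral R E] [Field F] [IsAlgClosed F] [Algebra E F] [IsFractionRing E F]
    (hE : ∀ {u a : E}, Polynomial.aeval a (minpoly R u) = 0 → ∃ σ : E →ₐ[R] E, σ u = a)
    (h : Algebra.IsPure R E) :
    ∃ (B : Type u) (_ : CommRing B) (_ : IsDomain B) (_ : Algebra R B)
      (_ : Algebra B F), IsIntegrallyClosed B ∧ IsFractionRing B F ∧
        HenselianLocalRing B ∧ IsLocalHom (algebraMap R B) ∧ Algebra.IsPure R B := by
  obtain ⟨n, hn⟩ := Ideal.exists_maximal E
  let f : Localization.AtPrime n →+* F := IsLocalization.lift (M := n.primeCompl)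
    (g := algebraMap E F) fun s ↦
      IsLocalization.map_units F ⟨s.1, n.primeCompl_le_nonZeroDivisors s.2⟩
  let _ : Algebra (Localization.AtPrime n) F := f.toAlgebra
  have : IsScalarTower E (Localization.AtPrime n) F :=
    .of_algebraMap_eq' (IsLocalization.lift_comp _).symm
  have hfrac : IsFractionRing (Localization.AtPrime n) F :=
    IsFractionRing.isFractionRing_of_isDomain_of_isLocalization n.primeCompl _ _
  have hdom : IsDomain (Localization.AtPrime n) := inferInstance
  have hcl : IsIntegrallyClosed (Localization.AtPrime n) :=
    isIntegrallyClosed_of_isLocalization _ n.primeCompl n.primeCompl_le_nonZeroDivisors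
  refine ⟨Localization.AtPrime n, inferInstance, hdom, inferInstance, inferInstance, hcl, hfrac,
    .of_isAlgClosed F, ?_, ?_⟩
  · refine ((local_hom_TFAE _).out 0 4 rfl rfl).mpr (eq_maximalIdeal ?_)
    rw [IsScalarTower.algebraMap_eq R E, ← Ideal.comap_comap]
    refine (congrArg (fun I ↦ (Ideal.comap _ I).IsMaximal)
      (IsLocalization.AtPrime.under_maximalIdeal _ n)).mpr ?_
    exact Ideal.isMaximal_comap_of_isIntegral_of_isMaximal n
  · exact Algebra.IsPure.of_isLocalization_atPrime F
      hE n _ h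

/-- A local splinter has a pure Henselian extension: the localization of its absolute integral
closure at a maximal ideal. -/
theorem IsSplinter.exists_isPure_henselianLocalRing {R : Type u} [CommRing R] [IsLocalRing R]
    [IsDomain R] (hR : IsSplinter R) (F : Type u) [Field F] [IsAlgClosed F] [Algebra R F]
    [Algebra (FractionRing R) F] [IsScalarTower R (FractionRing R) F]
    [Algebra.IsAlgebraic (FractionRing R) F] :
    ∃ (B : Type u) (_ : CommRing B) (_ : IsDomain B) (_ : Algebra R B)
      (_ : Algebra B F), IsIntegrallyClosed B ∧ IsFractionRing B F ∧
        HenselianLocalRing B ∧ IsLocalHom (algebraMap R B) ∧ Algebra.IsPure R B := by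
  have := hR.isIntegrallyClosed
  have : Normal (FractionRing R) F := { splits' := fun x ↦ IsAlgClosed.splits _ }
  have : IsFractionRing (integralClosure R F) F :=
    integralClosure.isFractionRing_of_algebraic_fractionRing
  have : IsIntegrallyClosed (integralClosure R F) := integralClosure_isIntegrallyClosed
  have : FaithfulSMul R (integralClosure R F) := (faithfulSMul_iff_algebraMap_injective _ _).mpr
    fun x y h ↦ IsFractionRing.injective R (FractionRing R)
      ((algebraMap (FractionRing R) F).injective (by
        rw [← IsScalarTower.algebraMap_apply, ← IsScalarTower.algebraMap_apply]
        exact congrArg Subtype.val h))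
  have h : Algebra.IsPure R (integralClosure R F) := hR.isPure_of_isIntegral _
  exact h.exists_isPure_henselianLocalRing (R := R) (E := integralClosure R F) (F := F)
    fun hu ↦ exists_algHom_apply_eq_of_aeval_minpoly_eq_zero hu

theorem IsSplinter.of_henselization {R : Type u} [CommRing R] [IsLocalRing R] [IsNoetherianRing R]
    (h : IsSplinter (Henselization R)) : IsSplinter R where
  isNoetherianRing := inferInstance
  exists_leftInverse S _ _ _ hS := by
    obtain ⟨φ, hφ⟩ := h.exists_leftInverse (TensorProduct R (Henselization R) S) inferInstance
      (PrimeSpectrum.comap_surjective_baseChange hS)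
    have h₁ : Algebra.IsPure R (Henselization R) :=
      .of_forall_nonempty_algHom fun _ ↦ Henselization.nonempty_algHom _
    have h₂ : Algebra.IsPure (Henselization R) (TensorProduct R (Henselization R) S) :=
      .of_leftInverse φ (by
        simpa only [LinearMap.comp_apply, Algebra.linearMap_apply, map_one] using!
          DFunLike.congr_fun hφ 1)
    exact ((h₁.trans h₂).of_algHom Algebra.TensorProduct.includeRight).exists_leftInverse

theorem IsSplinter.henselization {R : Type u} [CommRing R] [IsLocalRing R]
    (hR : IsSplinter R) : IsSplinter (Henselization R) := by
  have := hR.isNoetherianRing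
  refine ⟨inferInstance, fun T _ _ _ hT ↦ ?_⟩
  have := hR.isDomain
  obtain ⟨B, _, _, _, _, _, _, _, _, hB⟩ :=
    hR.exists_isPure_henselianLocalRing (AlgebraicClosure (FractionRing R))
  obtain ⟨f⟩ := Henselization.nonempty_algHom (R := R) B
  algebraize [f.toRingHom]
  have : IsScalarTower R (Henselization R) B := .of_algebraMap_eq' f.comp_algebraMap.symm
  have hHB : Algebra.IsPure (Henselization R) B :=
    hB.of_dense Henselization.map_maximalIdeal Henselization.exists_sub_mem_map
  -- T need not embed in B: an algebra map over Rʰ suffices for purity to pass to T.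
  obtain ⟨g⟩ := nonempty_algHom_of_isIntegrallyClosed hT (B := B)
    (AlgebraicClosure (FractionRing R))
  exact (hHB.of_algHom g).exists_leftInverse

theorem theoremB (R : Type u) [CommRing R] [IsLocalRing R] [IsNoetherianRing R] :
    IsSplinter R ↔ IsSplinter (Henselization R) :=
  ⟨IsSplinter.henselization, IsSplinter.of_henselization⟩
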